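/- Let $\mathcal H$ and $\mathcal G$ be real Hilbert spaces and let $L\colon\mathcal H\to\mathcal G$ be a bounded linear operator with $0<\|L\|\le 1$ and adjoint $L^*$. Let $g\colon\mathcal G\to\,]-\infty,+\infty]$ be proper (that is, not identically $+\infty$) and suppose that $g$ admits a continuous affine minorant. Notation. For a real Hilbert space $\mathcal K$: $\mathscr Q_{\mathcal K}=\|\cdot\|^2/2$; $\Gamma_0(\mathcal K)$ is the set of proper lower semicontinuous convex functions $\mathcal K\to\,]-\infty,+\infty]$; for $f\colon\mathcal K\to[-\infty,+\infty]$, the conjugate is $f^*(u)=\sup_{x\in\mathcal K}(\langle x,u\rangle-f(x))$, and $f^{**}=(f^*)^*$; the infimal convolution is $(f_1\mathbin{\square} f_2)(x)=\inf_{z\in\mathcal K}(f_1(z)+f_2(x-z))$. For proper $f$, the subdifferential is $\partial f(x)=\{u\in\mathcal K:\langle z-x,u\rangle+f(x)\le f(z)\ \text{for all } z\in\mathcal K\}$. For $f\in\Gamma_0(\mathcal K)$, $\operatorname{prox}_f(x)$ is the unique minimizer of $z\mapsto f(z)+\frac12\|x-z\|^2$. The inverse of a set-valued operator $A\colon\mathcal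 K\to 2^{\mathcal K}$ is given by $x\in A^{-1}u\Leftrightarrow u\in Ax$. For a set-valued operator $B\colon\mathcal G\to 2^{\mathcal G}$, the resolvent composition and the resolvent cocomposition of $B$ with $L$ are the operators $\mathcal H\to 2^{\mathcal H}$ $$L\diamond B=\big(L^*\circ(B+\mathrm{Id}_{\mathcal G})^{-1}\circ L\big)^{-1}-\mathrm{Id}_{\mathcal H},\qquad L\blacklozenge B=\big(L\diamond B^{-1}\big)^{-1}.$$ The proximal composition and the proximal cocomposition of a proper function $g$ with $L$ are $$L\diamond g=\big((g^*\mathbin{\square}\mathscr Q_{\mathcal G})\circ L\big)^*-\mathscr Q_{\mathcal H},\qquad L\blacklozenge g=\big(L\diamond g^*\big)^*.$$ Then the following hold: (i) $L\blacklozenge g\in\Gamma_0(\mathcal H)$. (ii) $L\blacklozenge\partial g^{**}=\partial(L\blacklozenge g)$. (iii) $\operatorname{prox}_{L\blacklozenge g}$ and $\operatorname{prox}_{g^{**}}$ are well defined (the minimizers defining them exist and are unique at every point), and $\operatorname{prox}_{L\blacklozenge g}=\mathrm{Id}_{\mathcal H}-L^*\circ L+L^*\circ\operatorname{prox}_{g^{**}}\circ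 L$. (iv) If $g\in\Gamma_0(\mathcal G)$, then $L\blacklozenge\partial g=\partial(L\blacklozenge g)$. (v) If $g\in\Gamma_0(\mathcal G)$, then $\operatorname{prox}_g$ is well defined and $\operatorname{prox}_{L\blacklozenge g}=\mathrm{Id}_{\mathcal H}-L^*\circ L+L^*\circ\operatorname{prox}_{g}\circ L$. -/

import Mathlib

noncomputable section

namespace ProxCocomp

/-! ### Set-valued operators -/

section SetValued

open scoped Pointwise

variable {H G : Type*}
  [NormedAddCommGroup H] [InnerProductSpace ℝ H] [CompleteSpace H]
  [NormedAddCommGroup G] [InnerProductSpace ℝ G] [CompleteSpace G]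

/-- The inverse of a set-valued operator `A : H → 2 ^ H`: `x ∈ A⁻¹ u` iff `u ∈ A x`. -/
def opInv (A : H → Set H) : H → Set H := fun u => {x | u ∈ A x}

/-- The operator `A + Id`. -/
def addId (A : H → Set H) : H → Set H := fun x => A x + {x}

/-- The operator `A - Id`. -/
def subId (A : H → Set H) : H → Set H := fun x => A x - {x}

/-- The parallel composition `L* ▷ B = (L* ∘ B⁻¹ ∘ L)⁻¹`. -/
def parallelComp (L : H →L[ℝ] G) (B : G → Set G) : H → Set H :=
  opInv fun x => ContinuousLinearMap.adjoint L '' opInv B (L x)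

/-- The resolvent composition `L ⋄ B = L* ▷ (B + Id) - Id`. -/
def resolventComp (L : H →L[ℝ] G) (B : G → Set G) : H → Set H :=
  subId (parallelComp L (addId B))

/-- The resolvent cocomposition, i.e. the inverse of the resolvent composition of `B⁻¹` with
`L`. -/
def resolventCocomp (L : H →L[ℝ] G) (B : G → Set G) : H → Set H :=
  opInv (resolventComp L (opInv B))

end SetValued

/-! ### Extended-real-valued functions -/

section Functions

variable {H G : Type*}
  [NormedAddCommGroup H] [InnerProductSpace ℝ H]
  [NormedAddCommGroup G] [InnerProductSpace ℝ G]

/-- `f` maps into `]-∞, +∞]` and is not identically `+∞`. -/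
structure IsProper (f : H → EReal) : Prop where
  ne_bot : ∀ x, f x ≠ ⊥
  exists_ne_top : ∃ x, f x ≠ ⊤

/-- The class `Γ₀(H)` of proper lower semicontinuous convex functions from `H` to `]-∞, +∞]`;
convexity means convexity of the epigraph. -/
structure IsGammaZero (f : H → EReal) : Prop where
  proper : IsProper f
  lsc : LowerSemicontinuous f
  convex : Convex ℝ {p : H × ℝ | f p.1 ≤ (p.2 : EReal)}

/-- `f` admits a continuous affine minorant. -/
def HasContinuousAffineMinorant (f : H → EReal) : Prop :=
  ∃ a : H →ᴬ[ℝ] ℝ, ∀ x, ((a x : ℝ) : EReal) ≤ f x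

/-- The canonical quadratic form `‖·‖² / 2`. -/
def quad (x : H) : EReal := ((‖x‖ ^ 2 / 2 : ℝ) : EReal)

/-- The conjugate `f*` of `f`. -/
def conj (f : H → EReal) : H → EReal :=
  fun u => ⨆ x, (((inner ℝ x u : ℝ) : EReal) - f x)

/-- The infimal convolution of `f` and `g`. -/
def infConv (f g : H → EReal) : H → EReal := fun x => ⨅ z, (f z + g (x - z))

/-- The proximal composition `L ⋄ g = ((g* □ ‖·‖²/2) ∘ L)* - ‖·‖²/2`. -/
def proxComp (L : H →L[ℝ] G) (g : G → EReal) : H → EReal :=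
  fun x => conj (fun w => infConv (conj g) quad (L w)) x - quad x

/-- The proximal cocomposition, i.e. the conjugate of the proximal composition of `g*` with
`L`. -/
def proxCocomp (L : H →L[ℝ] G) (g : G → EReal) : H → EReal :=
  conj (proxComp L (conj g))

/-- The subdifferential of `f`. -/
def subdiff (f : H → EReal) : H → Set H :=
  fun x => {u | ∀ z, ((inner ℝ (z - x) u : ℝ) : EReal) + f x ≤ f z}

/-- The set of global minimizers of `f`. -/
def argminSet (f : H → EReal) : Set H := {x | ∀ z, f x ≤ f z}

/-- The set of minimizers of `z ↦ f z + ‖x - z‖² / 2`. -/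
def proxSet (f : H → EReal) (x : H) : Set H := argminSet fun z => f z + quad (x - z)

/-- The proximity operator of `f`: `prox f x` is the minimizer of `z ↦ f z + ‖x - z‖² / 2`. It is
meaningful when `ProxWellDefined f` holds. -/
def prox (f : H → EReal) (x : H) : H := Classical.epsilon fun p => p ∈ proxSet f x

/-- For every `x`, the function `z ↦ f z + ‖x - z‖² / 2` has exactly one minimizer, so that
`prox f x` is that minimizer. -/
def ProxWellDefined (f : H → EReal) : Prop := ∀ x, ∃! p, p ∈ proxSet f x

end Functions

end ProxCocomp

end

/-! Everything is read off the map `J` = prox of `g**`. The envelope `e` of `g**`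
(`exists_envelope`) lies above its tangents, of slope `Id - J`, and satisfies the descent inequality
with constant 1. Both properties pass to `ψ = e ∘ L`, with slope `D = L* ∘ (Id - J) ∘ L`; the second
because `‖L‖ ≤ 1`. Since the cocomposition is `(ψ* - ‖·‖²/2)*`, evaluating this conjugate at `y - D
y` shows that `D y` is a subgradient there (`isProxMap_conj_conj_sub_quad`), so `Id - D` is its
proximal map.

A proximal map determines the graph of the subdifferential, so the operator identity becomes an
equation between points (`resolventCocomp_subdiff`). Fenchel–Moreau is not needed for `g ∈ Γ₀`:
subgradients of `g` are subgradients of `g**`, hence both functions have the same `J`. -/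

namespace ProxCocomp

variable {H G : Type*}
  [NormedAddCommGroup H] [InnerProductSpace ℝ H]
  [NormedAddCommGroup G] [InnerProductSpace ℝ G]

/-! ### Subgradients and proximal maps -/

/-- `J` selects, for every `z`, a point `J z` such that `z - J z` is a subgradient of `f` at
`J z`; for proper `f`, this says that `J` is the resolvent of the subdifferential of `f`. -/
def IsProxMap (f : H → EReal) (J : H → H) : Prop := ∀ z, z - J z ∈ subdiff f (J z)

theorem IsProper.exists_real {f : H → EReal} (hf : IsProper f) {x : H} (hx : f x ≠ ⊤) :
    ∃ r : ℝ, f x = (r : EReal) :=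
  ⟨(f x).toReal, (EReal.coe_toReal hx (hf.ne_bot x)).symm⟩

theorem mem_subdiff_of_real {f : H → EReal} {x u : H} {r : ℝ} (hx : f x = (r : EReal))
    (h : ∀ z, ((inner ℝ (z - x) u + r : ℝ) : EReal) ≤ f z) : u ∈ subdiff f x := by
  intro z
  rw [hx]
  exact_mod_cast h z

theorem IsProper.exists_real_of_mem_subdiff {f : H → EReal} (hf : IsProper f) {x u : H}
    (hu : u ∈ subdiff f x) :
    ∃ r : ℝ, f x = (r : EReal) ∧ ∀ z, ((inner ℝ (z - x) u + r : ℝ) : EReal) ≤ f z := by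
  have hx : f x ≠ ⊤ := by
    intro hx
    obtain ⟨z, hz⟩ := hf.exists_ne_top
    have h := hu z
    rw [hx, EReal.coe_add_top, top_le_iff] at h
    exact hz h
  obtain ⟨r, hr⟩ := hf.exists_real hx
  refine ⟨r, hr, fun z => ?_⟩
  have h := hu z
  rw [hr] at h
  exact_mod_cast h

/-- A subgradient `u` at `x` makes `x` a minimizer of `f + ‖x + u - ·‖² / 2`, with quadratic
growth. -/
theorem IsProper.add_quad_le_of_mem_subdiff {f : H → EReal} (hf : IsProper f) {x u : H}
    (hu : u ∈ subdiff f x) (w : H) :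
    f x + quad (x + u - x) + quad (w - x) ≤ f w + quad (x + u - w) := by
  obtain ⟨r, hr, h⟩ := hf.exists_real_of_mem_subdiff hu
  by_cases hw : f w = ⊤
  · simp [hw, quad]
  obtain ⟨s, hs⟩ := hf.exists_real hw
  have h1 := h w
  rw [hs, EReal.coe_le_coe_iff] at h1
  have h2 := norm_sub_sq_real u (w - x)
  rw [real_inner_comm] at h2
  rw [hr, hs, show x + u - w = u - (w - x) by abel, add_sub_cancel_left]
  simp only [quad]
  norm_cast
  linarith

theorem IsProper.mem_proxSet_of_mem_subdiff {f : H → EReal} (hf : IsProper f) {x u : H}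
    (hu : u ∈ subdiff f x) : x ∈ proxSet f (x + u) := by
  intro w
  refine le_trans ?_ (hf.add_quad_le_of_mem_subdiff hu w)
  have : (0 : EReal) ≤ quad (w - x) := by
    unfold quad
    exact_mod_cast (by positivity : (0 : ℝ) ≤ ‖w - x‖ ^ 2 / 2)
  exact le_add_of_nonneg_right this

theorem IsProper.eq_of_mem_proxSet {f : H → EReal} (hf : IsProper f) {x u p : H}
    (hu : u ∈ subdiff f x) (hp : p ∈ proxSet f (x + u)) : p = x := by
  have h := (hf.add_quad_le_of_mem_subdiff hu p).trans (hp x)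
  obtain ⟨r, hr, -⟩ := hf.exists_real_of_mem_subdiff hu
  simp only [hr, quad] at h
  norm_cast at h
  have h0 : ‖p - x‖ ^ 2 = 0 := le_antisymm (by linarith) (sq_nonneg _)
  exact sub_eq_zero.1 (norm_eq_zero.1 (pow_eq_zero_iff two_ne_zero |>.1 h0))

section IsProxMap

variable {f : H → EReal} {J : H → H}

theorem IsProxMap.mem_proxSet_iff (hJ : IsProxMap f J) (hf : IsProper f) {z p : H} :
    p ∈ proxSet f z ↔ p = J z := by
  constructor
  · intro hp
    exact hf.eq_of_mem_proxSet (hJ z) (by rwa [add_sub_cancel])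
  · rintro rfl
    simpa using hf.mem_proxSet_of_mem_subdiff (hJ z)

theorem IsProxMap.proxWellDefined (hJ : IsProxMap f J) (hf : IsProper f) :
    ProxWellDefined f := fun z =>
  ⟨J z, (hJ.mem_proxSet_iff hf).2 rfl, fun _ hp => (hJ.mem_proxSet_iff hf).1 hp⟩

theorem IsProxMap.prox_eq (hJ : IsProxMap f J) (hf : IsProper f) (z : H) : prox f z = J z :=
  (hJ.mem_proxSet_iff hf).1
    (Classical.epsilon_spec (p := fun p => p ∈ proxSet f z)
      ⟨J z, (hJ.mem_proxSet_iff hf).2 rfl⟩)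

/-- The graph of the subdifferential is encoded by `J` alone; this turns identities of set-valued
operators into point equations. -/
theorem IsProxMap.mem_subdiff_iff (hJ : IsProxMap f J) (hf : IsProper f) {x u : H} :
    u ∈ subdiff f x ↔ x = J (x + u) := by
  constructor
  · intro hu
    exact (hJ.mem_proxSet_iff hf).1 (hf.mem_proxSet_of_mem_subdiff hu)
  · intro h
    have h1 := hJ (x + u)
    rw [← h, add_sub_cancel_left] at h1
    exact h1

end IsProxMap

/-! ### Existence of proximal points -/

/-- The first-order condition for minimizing `r + ‖z - w‖² / 2` over `(w, r)` in a convex set. -/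
theorem inner_add_le_of_minimizer {E : Set (H × ℝ)} (hE : Convex ℝ E) {z : H} {p q : H × ℝ}
    (hp : p ∈ E) (hq : q ∈ E)
    (hmin : ∀ q ∈ E, p.2 + ‖z - p.1‖ ^ 2 / 2 ≤ q.2 + ‖z - q.1‖ ^ 2 / 2) :
    inner ℝ (q.1 - p.1) (z - p.1) + p.2 ≤ q.2 := by
  -- Compare `p` with points of the segment towards `q` and divide by `t`; the error vanishes as `t
  -- → 0`.
  have key : ∀ t ∈ Set.Ioc (0 : ℝ) 1,
      inner ℝ (q.1 - p.1) (z - p.1) + p.2 - q.2 ≤ t * (‖q.1 - p.1‖ ^ 2 / 2) := by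
    intro t ht
    have h := hmin _ (hE.add_smul_sub_mem hp hq ⟨ht.1.le, ht.2⟩)
    simp only [Prod.fst_add, Prod.smul_fst, Prod.fst_sub, Prod.snd_add, Prod.smul_snd,
      Prod.snd_sub, smul_eq_mul] at h
    have h2 := norm_sub_sq_real (z - p.1) (t • (q.1 - p.1))
    rw [sub_sub, inner_smul_right, norm_smul, Real.norm_of_nonneg ht.1.le, real_inner_comm,
      mul_pow] at h2
    have h3 : t * (inner ℝ (q.1 - p.1) (z - p.1) + p.2 - q.2) ≤
        t * (t * (‖q.1 - p.1‖ ^ 2 / 2)) := by linarith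
    exact le_of_mul_le_mul_left h3 ht.1
  have hlim : Filter.Tendsto (fun t : ℝ => t * (‖q.1 - p.1‖ ^ 2 / 2)) (nhdsWithin 0 (Set.Ioi 0))
      (nhds 0) := by
    have : Filter.Tendsto (fun t : ℝ => t * (‖q.1 - p.1‖ ^ 2 / 2)) (nhds 0) (nhds (0 * _)) :=
      Filter.tendsto_id.mul_const _
    rw [zero_mul] at this
    exact this.mono_left nhdsWithin_le_nhds
  have := ge_of_tendsto hlim (Filter.mem_of_superset (Ioc_mem_nhdsGT one_pos) key)
  linarith

/-- Strong convexity of `r + ‖z - w‖² / 2`: points of a convex set that almost minimize it are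
close to each other. -/
theorem norm_sub_sq_le_of_almost_minimizer {E : Set (H × ℝ)} (hE : Convex ℝ E) {z : H} {m a : ℝ}
    (hm : ∀ q ∈ E, m ≤ q.2 + ‖z - q.1‖ ^ 2 / 2) {p q : H × ℝ} (hp : p ∈ E) (hq : q ∈ E)
    (hpa : p.2 + ‖z - p.1‖ ^ 2 / 2 ≤ m + a) (hqa : q.2 + ‖z - q.1‖ ^ 2 / 2 ≤ m + a) :
    ‖p.1 - q.1‖ ^ 2 ≤ 8 * a := by
  -- At the midpoint the objective is the average minus `‖p.1 - q.1‖² / 8`, whence the constant 8.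
  have h := hm _ (hE hp hq (by norm_num : (0 : ℝ) ≤ 1 / 2) (by norm_num : (0 : ℝ) ≤ 1 / 2)
    (by norm_num))
  simp only [Prod.fst_add, Prod.smul_fst, Prod.snd_add, Prod.smul_snd, smul_eq_mul] at h
  have h1 : z - ((1 / 2 : ℝ) • p.1 + (1 / 2 : ℝ) • q.1) =
      (1 / 2 : ℝ) • ((z - p.1) + (z - q.1)) := by module
  have h2 := parallelogram_law_with_norm ℝ (z - p.1) (z - q.1)
  have h3 : z - p.1 - (z - q.1) = -(p.1 - q.1) := by abel
  rw [h1, norm_smul, Real.norm_of_nonneg (by norm_num : (0 : ℝ) ≤ 1 / 2)] at h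
  rw [h3, norm_neg] at h2
  nlinarith

theorem exists_minimizer [CompleteSpace H] {E : Set (H × ℝ)} (hE : Convex ℝ E)
    (hcl : IsClosed E) (hne : E.Nonempty) (z : H)
    (hbdd : ∃ c, ∀ q ∈ E, c ≤ q.2 + ‖z - q.1‖ ^ 2 / 2) :
    ∃ p ∈ E, ∀ q ∈ E, p.2 + ‖z - p.1‖ ^ 2 / 2 ≤ q.2 + ‖z - q.1‖ ^ 2 / 2 := by
  set v : H × ℝ → ℝ := fun q => q.2 + ‖z - q.1‖ ^ 2 / 2 with hv
  obtain ⟨c, hc⟩ := hbdd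
  have hglb : IsGLB (v '' E) (sInf (v '' E)) :=
    isGLB_csInf (hne.image v) ⟨c, by rintro _ ⟨q, hq, rfl⟩; exact hc q hq⟩
  set m := sInf (v '' E)
  have hm : ∀ q ∈ E, m ≤ v q := fun q hq => hglb.1 ⟨q, hq, rfl⟩
  have hseq : ∀ n : ℕ, ∃ q ∈ E, v q < m + 1 / ((n : ℝ) + 1) := by
    intro n
    obtain ⟨_, ⟨q, hq, rfl⟩, -, h⟩ := hglb.exists_between (lt_add_of_pos_right m
      (Nat.one_div_pos_of_nat (α := ℝ) (n := n)))
    exact ⟨q, hq, h⟩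
  choose q hqE hqm using hseq
  have hv_lim : Filter.Tendsto (fun n => v (q n)) Filter.atTop (nhds m) := by
    have h := (tendsto_one_div_add_atTop_nhds_zero_nat (𝕜 := ℝ)).const_add m
    rw [add_zero] at h
    exact tendsto_of_tendsto_of_tendsto_of_le_of_le tendsto_const_nhds h
      (fun n => hm _ (hqE n)) (fun n => (hqm n).le)
  have hcau : CauchySeq fun n => (q n).1 := by
    refine cauchySeq_of_le_tendsto_0 (fun n : ℕ => √(8 * (1 / ((n : ℝ) + 1)))) ?_ ?_
    · intro i j N hi hj
      rw [dist_eq_norm]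
      refine Real.le_sqrt_of_sq_le (norm_sub_sq_le_of_almost_minimizer hE hm (hqE i) (hqE j)
        ((hqm i).le.trans ?_) ((hqm j).le.trans ?_))
      · gcongr
      · gcongr
    · have h := ((tendsto_one_div_add_atTop_nhds_zero_nat (𝕜 := ℝ)).const_mul 8).sqrt
      simpa using h
  obtain ⟨p, hp⟩ := cauchySeq_tendsto_of_complete hcau
  -- The objective values and the first coordinates converge, so the second coordinates do too.
  have hr : Filter.Tendsto (fun n => (q n).2) Filter.atTop (nhds (m - ‖z - p‖ ^ 2 / 2)) := by
    have h := hv_lim.sub ((((tendsto_const_nhds (x := z)).sub hp).norm.pow 2).div_const 2)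
    refine h.congr fun n => ?_
    simp [hv]
  refine ⟨(p, m - ‖z - p‖ ^ 2 / 2),
    hcl.mem_of_tendsto (hp.prodMk_nhds hr) (Filter.Eventually.of_forall hqE), fun q hq => ?_⟩
  have := hm q hq
  simpa using this

/-- Minimizing over the epigraph keeps the argument in `H × ℝ`: it is closed and convex, and the
first-order condition at a minimizer is the subgradient inequality. -/
theorem IsGammaZero.exists_isProxMap [CompleteSpace H] {f : H → EReal} (hf : IsGammaZero f)
    (ha : HasContinuousAffineMinorant f) : ∃ J, IsProxMap f J := by
  suffices h : ∀ z, ∃ p, z - p ∈ subdiff f p by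
    choose J hJ using h
    exact ⟨J, hJ⟩
  intro z
  have hcl : IsClosed {p : H × ℝ | f p.1 ≤ (p.2 : EReal)} :=
    hf.lsc.isClosed_epigraph.preimage
      (continuous_fst.prodMk (continuous_coe_real_ereal.comp continuous_snd))
  have hne : {p : H × ℝ | f p.1 ≤ (p.2 : EReal)}.Nonempty := by
    obtain ⟨x, hx⟩ := hf.proper.exists_ne_top
    obtain ⟨r, hr⟩ := hf.proper.exists_real hx
    exact ⟨(x, r), hr.le⟩
  have hbdd : ∃ c, ∀ q ∈ {p : H × ℝ | f p.1 ≤ (p.2 : EReal)}, c ≤ q.2 + ‖z - q.1‖ ^ 2 / 2 := by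
    obtain ⟨a, ha⟩ := ha
    -- With `s` the norm of the linear part and `t = ‖z - q.1‖`, use `t² / 2 - s * t ≥ -s² / 2`.
    refine ⟨a z - ‖a.contLinear‖ ^ 2 / 2, fun q hq => ?_⟩
    have h1 : a q.1 ≤ q.2 := EReal.coe_le_coe_iff.1 ((ha q.1).trans hq)
    have h2 : a z - a q.1 = a.contLinear (z - q.1) := by
      simpa using (a.contLinear_map_vsub z q.1).symm
    have h3 := (le_abs_self _).trans (a.contLinear.le_opNorm (z - q.1))
    nlinarith [sq_nonneg (‖a.contLinear‖ - ‖z - q.1‖)]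
  obtain ⟨p, hp, hmin⟩ := exists_minimizer hf.convex hcl hne z hbdd
  have hvar := fun q hq => inner_add_le_of_minimizer hf.convex (q := q) hp hq hmin
  have hptop : f p.1 ≠ ⊤ := fun h => by
    have : f p.1 ≤ (p.2 : EReal) := hp
    simp [h] at this
  obtain ⟨r, hr⟩ := hf.proper.exists_real hptop
  have hrp : p.2 ≤ r := by simpa using hvar (p.1, r) hr.le
  have hpr : r ≤ p.2 := by
    have : f p.1 ≤ (p.2 : EReal) := hp
    rwa [hr, EReal.coe_le_coe_iff] at this
  obtain rfl : r = p.2 := le_antisymm hpr hrp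
  refine ⟨p.1, mem_subdiff_of_real hr fun w => ?_⟩
  by_cases hw : f w = ⊤
  · simp [hw]
  obtain ⟨s, hs⟩ := hf.proper.exists_real hw
  rw [hs, EReal.coe_le_coe_iff]
  exact hvar (w, s) hs.le

/-! ### Conjugates -/

theorem le_conj (f : H → EReal) (x u : H) : ((inner ℝ x u : ℝ) : EReal) - f x ≤ conj f u :=
  le_iSup (fun x => ((inner ℝ x u : ℝ) : EReal) - f x) x

theorem conj_ne_bot {f : H → EReal} (hf : ∃ x, f x ≠ ⊤) (u : H) : conj f u ≠ ⊥ := by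
  obtain ⟨x, hx⟩ := hf
  intro h
  have h1 := le_conj f x u
  rw [h, le_bot_iff, sub_eq_add_neg, EReal.add_eq_bot_iff] at h1
  simp [hx] at h1

theorem lowerSemicontinuous_conj (f : H → EReal) : LowerSemicontinuous (conj f) := by
  refine lowerSemicontinuous_iSup fun x => Continuous.lowerSemicontinuous ?_
  have hc : Continuous fun u : H => ((inner ℝ x u : ℝ) : EReal) :=
    continuous_coe_real_ereal.comp (by fun_prop)
  induction h : f x with
  | bot => simpa using continuous_const
  | top => simpa using continuous_const
  | coe r =>
    have : Continuous fun u : H => ((inner ℝ x u - r : ℝ) : EReal) :=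
      continuous_coe_real_ereal.comp (by fun_prop)
    simpa using this

theorem convex_epigraph_conj (f : H → EReal) :
    Convex ℝ {p : H × ℝ | conj f p.1 ≤ (p.2 : EReal)} := by
  simp only [conj, iSup_le_iff, Set.ofPred_forall]
  refine convex_iInter fun x => ?_
  induction h : f x with
  | bot => simpa using convex_empty
  | top => simpa using convex_univ
  | coe r =>
    have : {p : H × ℝ | ((inner ℝ x p.1 : ℝ) : EReal) - (r : EReal) ≤ (p.2 : EReal)} =
        {p : H × ℝ | inner ℝ x p.1 - p.2 ≤ r} := by
      ext p
      simp only [Set.mem_ofPred_eq]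
      norm_cast
      constructor <;> intro h <;> linarith
    rw [this]
    refine convex_halfSpace_le ⟨fun p q => ?_, fun c p => ?_⟩ r
    · simp only [Prod.fst_add, Prod.snd_add, inner_add_right]
      ring
    · simp only [Prod.smul_fst, Prod.smul_snd, inner_smul_right, smul_eq_mul]
      ring

theorem isGammaZero_conj {f : H → EReal} (hf : IsProper (conj f)) : IsGammaZero (conj f) :=
  ⟨hf, lowerSemicontinuous_conj f, convex_epigraph_conj f⟩

theorem IsProper.conj_of_minorant [CompleteSpace H] {f : H → EReal} (hf : IsProper f)
    (ha : HasContinuousAffineMinorant f) : IsProper (conj f) := by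
  refine ⟨conj_ne_bot hf.exists_ne_top, ?_⟩
  obtain ⟨a, ha⟩ := ha
  set u := (InnerProductSpace.toDual ℝ H).symm a.contLinear
  have hu : ∀ x, a x = inner ℝ x u + a 0 := by
    intro x
    have h2 : a x - a 0 = a.contLinear (x - 0) := by
      simpa using (a.contLinear_map_vsub x 0).symm
    rw [real_inner_comm, InnerProductSpace.toDual_symm_apply]
    rw [sub_zero] at h2
    linarith
  refine ⟨u, ne_top_of_le_ne_top (EReal.coe_ne_top (-(a 0))) (iSup_le fun x => ?_)⟩
  have h := ha x
  by_cases hx : f x = ⊤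
  · simp [hx]
  obtain ⟨r, hr⟩ := hf.exists_real hx
  rw [hr, EReal.coe_le_coe_iff, hu] at h
  rw [hr]
  norm_cast
  linarith

theorem IsProper.conj_conj_le {f : H → EReal} (hf : IsProper f) (x : H) :
    conj (conj f) x ≤ f x := by
  by_cases hx : f x = ⊤
  · simp [hx]
  obtain ⟨r, hr⟩ := hf.exists_real hx
  refine iSup_le fun u => ?_
  have h := le_conj f x u
  rw [hr] at h ⊢
  induction hc : conj f u with
  | bot => exact absurd hc (conj_ne_bot hf.exists_ne_top u)
  | top => simp
  | coe s =>
    rw [hc] at h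
    norm_cast at h ⊢
    rw [real_inner_comm]
    linarith

theorem IsProper.conj_conj [CompleteSpace H] {f : H → EReal} (hf : IsProper f)
    (ha : HasContinuousAffineMinorant f) : IsProper (conj (conj f)) := by
  refine ⟨conj_ne_bot (hf.conj_of_minorant ha).exists_ne_top, ?_⟩
  obtain ⟨x, hx⟩ := hf.exists_ne_top
  exact ⟨x, ne_top_of_le_ne_top hx (hf.conj_conj_le x)⟩

theorem IsProper.hasContinuousAffineMinorant_conj {f : H → EReal} (hf : IsProper f) :
    HasContinuousAffineMinorant (conj f) := by
  obtain ⟨u, hu⟩ := hf.exists_ne_top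
  obtain ⟨r, hr⟩ := hf.exists_real hu
  refine ⟨(innerSL ℝ u).toContinuousAffineMap - ContinuousAffineMap.const ℝ H r, fun x => ?_⟩
  have h := le_conj f u x
  rw [hr] at h
  exact_mod_cast h

/-- A subgradient gives `f* u ≤ ⟨x, u⟩ - f x`; combine this with `f** ≤ f`. -/
theorem mem_subdiff_conj_conj {f : H → EReal} (hf : IsProper f) {x u : H}
    (hu : u ∈ subdiff f x) : u ∈ subdiff (conj (conj f)) x := by
  obtain ⟨r, hr, h⟩ := hf.exists_real_of_mem_subdiff hu
  have hc : conj f u ≤ ((inner ℝ x u - r : ℝ) : EReal) := by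
    refine iSup_le fun z => ?_
    by_cases hz : f z = ⊤
    · simp [hz]
    obtain ⟨s, hs⟩ := hf.exists_real hz
    have h1 := h z
    rw [hs, EReal.coe_le_coe_iff, inner_sub_left] at h1
    rw [hs]
    norm_cast
    linarith
  intro z
  calc ((inner ℝ (z - x) u : ℝ) : EReal) + conj (conj f) x
      ≤ ((inner ℝ (z - x) u : ℝ) : EReal) + f x := by gcongr; exact hf.conj_conj_le x
    _ = ((inner ℝ u z : ℝ) : EReal) - ((inner ℝ x u - r : ℝ) : EReal) := by
      rw [hr, inner_sub_left, real_inner_comm u z]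
      norm_cast
      ring
    _ ≤ ((inner ℝ u z : ℝ) : EReal) - conj f u := EReal.sub_le_sub le_rfl hc
    _ ≤ conj (conj f) z := le_conj _ _ _

/-! ### The Moreau envelope -/

/-- The envelope `f □ ‖·‖²/2` of a function with a proximal map is real-valued, lies above its
tangents, and satisfies the descent inequality; its gradient is `Id - J`. -/
theorem IsProxMap.exists_envelope {f : H → EReal} {J : H → H} (hJ : IsProxMap f J)
    (hf : IsProper f) :
    ∃ e : H → ℝ, (∀ z, infConv f quad z = (e z : EReal)) ∧
      (∀ y z, e y + inner ℝ (z - y) (y - J y) ≤ e z) ∧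
      (∀ y z, e z ≤ e y + inner ℝ (z - y) (y - J y) + ‖z - y‖ ^ 2 / 2) := by
  choose r hr h using fun z => hf.exists_real_of_mem_subdiff (hJ z)
  have heq : ∀ z, infConv f quad z = ((r z + ‖z - J z‖ ^ 2 / 2 : ℝ) : EReal) := by
    intro z
    refine le_antisymm ((iInf_le _ (J z)).trans_eq ?_) (le_iInf fun w => ?_)
    · simp [hr, quad]
    · have := (hJ.mem_proxSet_iff hf (z := z)).2 rfl w
      simpa [hr, quad] using this
  refine ⟨fun z => r z + ‖z - J z‖ ^ 2 / 2, heq, fun y z => ?_, fun y z => ?_⟩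
  -- The slack in the tangent inequality is at least half the square in `h3`.
  · have h1 := h y (J z)
    rw [hr z, EReal.coe_le_coe_iff] at h1
    have h2 := norm_sub_sq_real (z - J z) (y - J y)
    have h3 := sq_nonneg ‖z - J z - (y - J y)‖
    have h4 : inner ℝ (z - y) (y - J y) = inner ℝ (z - J z) (y - J y) -
        inner ℝ (y - J y) (y - J y) + inner ℝ (J z - J y) (y - J y) := by
      rw [← inner_sub_left, ← inner_add_left]
      congr 1
      abel
    rw [real_inner_self_eq_norm_sq] at h4
    linarith
  · have h1 : infConv f quad z ≤ _ := iInf_le _ (J y)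
    rw [heq, hr y] at h1
    simp only [quad] at h1
    norm_cast at h1
    have h2 := norm_add_sq_real (z - y) (y - J y)
    rw [sub_add_sub_cancel] at h2
    linarith

/-! ### Subtracting the quadratic from a conjugate -/

/-- If `ψ` lies above its tangents of slope `D` and satisfies the descent inequality, then
`(ψ* - ‖·‖²/2)*` has the proximal map `Id - D`. -/
theorem isProxMap_conj_conj_sub_quad {ψ : H → ℝ} {D : H → H}
    (hlow : ∀ y z, ψ y + inner ℝ (z - y) (D y) ≤ ψ z)
    (hup : ∀ y z, ψ z ≤ ψ y + inner ℝ (z - y) (D y) + ‖z - y‖ ^ 2 / 2) :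
    IsProper (conj fun u => conj (fun w => (ψ w : EReal)) u - quad u) ∧
      IsProxMap (conj fun u => conj (fun w => (ψ w : EReal)) u - quad u) fun y => y - D y := by
  set F : H → EReal := conj fun u => conj (fun w => (ψ w : EReal)) u - quad u
  have hconj : ∀ y,
      conj (fun w => (ψ w : EReal)) (D y) ≤ ((inner ℝ y (D y) - ψ y : ℝ) : EReal) := by
    refine fun y => iSup_le fun z => ?_
    have := hlow y z
    rw [inner_sub_left] at this
    beta_reduce
    norm_cast
    linarith
  have hge : ∀ x y, ((ψ y + inner ℝ (x - y) (D y) + ‖D y‖ ^ 2 / 2 : ℝ) : EReal) ≤ F x := by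
    intro x y
    refine le_trans ?_ (le_conj _ (D y) x)
    have h1 : conj (fun w => (ψ w : EReal)) (D y) - quad (D y) ≤
        ((inner ℝ y (D y) - ψ y - ‖D y‖ ^ 2 / 2 : ℝ) : EReal) := by
      rw [EReal.coe_sub]
      exact EReal.sub_le_sub (hconj y) le_rfl
    refine le_trans ?_ (EReal.sub_le_sub le_rfl h1)
    norm_cast
    rw [inner_sub_left, real_inner_comm]
    linarith
  have hle : ∀ y, F (y - D y) ≤ ((ψ y - ‖D y‖ ^ 2 / 2 : ℝ) : EReal) := by
    refine fun y => iSup_le fun u => ?_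
    -- This test point makes the descent bound cancel every term in `u`.
    have h1 := EReal.sub_le_sub (le_conj (fun w => (ψ w : EReal)) (y - D y + u) u)
      (le_refl (quad u))
    refine (EReal.sub_le_sub le_rfl h1).trans ?_
    simp only [quad]
    norm_cast
    have h2 := hup y (y - D y + u)
    rw [show y - D y + u - y = u - D y by abel, inner_sub_left, real_inner_self_eq_norm_sq] at h2
    have h3 := norm_sub_sq_real u (D y)
    rw [inner_add_left, real_inner_self_eq_norm_sq, real_inner_comm u]
    linarith
  have heq : ∀ y, F (y - D y) = ((ψ y - ‖D y‖ ^ 2 / 2 : ℝ) : EReal) := by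
    refine fun y => le_antisymm (hle y) (le_trans (le_of_eq ?_) (hge _ y))
    rw [sub_sub_cancel_left, inner_neg_left, real_inner_self_eq_norm_sq]
    congr 1
    ring
  refine ⟨⟨fun x hx => ?_, 0 - D 0, ?_⟩, fun y => mem_subdiff_of_real (heq y) fun z => ?_⟩
  · have := hge x x
    rw [hx, le_bot_iff] at this
    exact EReal.coe_ne_bot _ this
  · rw [heq]
    exact EReal.coe_ne_top _
  · refine le_trans (le_of_eq ?_) (hge z y)
    rw [sub_sub_cancel, show z - (y - D y) = (z - y) + D y by abel, inner_add_left,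
      real_inner_self_eq_norm_sq]
    congr 1
    ring

/-! ### The proximal cocomposition -/

variable [CompleteSpace H] [CompleteSpace G]

theorem isProxMap_proxCocomp (L : H →L[ℝ] G) (hL : ‖L‖ ≤ 1) {g : G → EReal} {J : G → G}
    (hg : IsProper (conj (conj g))) (hJ : IsProxMap (conj (conj g)) J) :
    IsProper (proxCocomp L g) ∧ IsProxMap (proxCocomp L g) fun x =>
      x - ContinuousLinearMap.adjoint L (L x - J (L x)) := by
  obtain ⟨e, he, hlow, hup⟩ := hJ.exists_envelope hg
  have hF : proxCocomp L g =
      conj fun u => conj (fun w => ((e (L w) : ℝ) : EReal)) u - quad u := by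
    unfold proxCocomp proxComp
    simp only [he]
  rw [hF]
  refine isProxMap_conj_conj_sub_quad (ψ := fun w => e (L w)) (fun y z => ?_) fun y z => ?_
  · rw [ContinuousLinearMap.adjoint_inner_right, map_sub]
    exact hlow _ _
  · rw [ContinuousLinearMap.adjoint_inner_right, map_sub]
    refine (hup (L y) (L z)).trans ?_
    have : ‖L z - L y‖ ≤ ‖z - y‖ := by
      rw [← map_sub]
      exact L.le_of_opNorm_le_of_le hL le_rfl |>.trans_eq (one_mul _)
    gcongr

/-- Here `v` is a value of the resolvent of `B⁻¹` at `L (x + u)`. -/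
theorem mem_resolventCocomp_iff (L : H →L[ℝ] G) (B : G → Set G) {x u : H} :
    u ∈ resolventCocomp L B x ↔
      ∃ v, v ∈ B (L (x + u) - v) ∧ ContinuousLinearMap.adjoint L v = u := by
  simp only [resolventCocomp, resolventComp, subId, parallelComp, addId, opInv, Set.mem_ofPred_eq,
    Set.sub_singleton, Set.add_singleton, Set.mem_image]
  constructor
  · rintro ⟨y, ⟨v, ⟨w, hw, hwv⟩, hv⟩, rfl⟩
    refine ⟨v, ?_, hv⟩
    rwa [sub_add_cancel, ← hwv, add_sub_cancel_right]
  · rintro ⟨v, hB, hv⟩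
    exact ⟨x + u, ⟨v, ⟨_, hB, sub_add_cancel _ _⟩, hv⟩, add_sub_cancel_right _ _⟩

theorem resolventCocomp_subdiff (L : H →L[ℝ] G) {k : G → EReal} {f : H → EReal} {J : G → G}
    (hk : IsProper k) (hJ : IsProxMap k J) (hf : IsProper f)
    (hfJ : IsProxMap f fun x => x - ContinuousLinearMap.adjoint L (L x - J (L x))) :
    resolventCocomp L (subdiff k) = subdiff f := by
  ext x u
  rw [mem_resolventCocomp_iff, hfJ.mem_subdiff_iff hf]
  simp only [hJ.mem_subdiff_iff hk, sub_add_cancel]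
  constructor
  · rintro ⟨v, hv, hu⟩
    rw [← hv, sub_sub_cancel, hu, add_sub_cancel_right]
  · intro h
    refine ⟨L (x + u) - J (L (x + u)), sub_sub_cancel _ _, ?_⟩
    exact add_left_cancel (eq_sub_iff_add_eq.1 h)

end ProxCocomp

open ProxCocomp in
theorem mainTheorem9 {H G : Type*}
    [NormedAddCommGroup H] [InnerProductSpace ℝ H] [CompleteSpace H]
    [NormedAddCommGroup G] [InnerProductSpace ℝ G] [CompleteSpace G]
    (L : H →L[ℝ] G) (hL_pos : 0 < ‖L‖) (hL_le : ‖L‖ ≤ 1)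
    (g : G → EReal) (hg : ProxCocomp.IsProper g)
    (hg_minorant : ProxCocomp.HasContinuousAffineMinorant g) :
    ProxCocomp.IsGammaZero (ProxCocomp.proxCocomp L g) ∧
    ProxCocomp.resolventCocomp L (ProxCocomp.subdiff (ProxCocomp.conj (ProxCocomp.conj g))) =
      ProxCocomp.subdiff (ProxCocomp.proxCocomp L g) ∧
    (ProxCocomp.ProxWellDefined (ProxCocomp.proxCocomp L g) ∧
      ProxCocomp.ProxWellDefined (ProxCocomp.conj (ProxCocomp.conj g)) ∧
      ∀ x : H, ProxCocomp.prox (ProxCocomp.proxCocomp L g) x =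
        x - ContinuousLinearMap.adjoint L (L x) +
          ContinuousLinearMap.adjoint L
            (ProxCocomp.prox (ProxCocomp.conj (ProxCocomp.conj g)) (L x))) ∧
    (ProxCocomp.IsGammaZero g →
      ProxCocomp.resolventCocomp L (ProxCocomp.subdiff g) =
        ProxCocomp.subdiff (ProxCocomp.proxCocomp L g)) ∧
    (ProxCocomp.IsGammaZero g →
      ProxCocomp.ProxWellDefined g ∧
      ∀ x : H, ProxCocomp.prox (ProxCocomp.proxCocomp L g) x =
        x - ContinuousLinearMap.adjoint L (L x) +
          ContinuousLinearMap.adjoint L (ProxCocomp.prox g (L x))) := by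
  have hk := hg.conj_conj hg_minorant
  have hkmin := (hg.conj_of_minorant hg_minorant).hasContinuousAffineMinorant_conj
  obtain ⟨J, hJ⟩ := (isGammaZero_conj hk).exists_isProxMap hkmin
  obtain ⟨hf, hfJ⟩ := isProxMap_proxCocomp L hL_le hk hJ
  have hprox : ∀ x, prox (proxCocomp L g) x =
      x - ContinuousLinearMap.adjoint L (L x) + ContinuousLinearMap.adjoint L (J (L x)) := by
    intro x
    rw [hfJ.prox_eq hf, map_sub, sub_sub_eq_add_sub, add_sub_right_comm]
  refine ⟨isGammaZero_conj hf, resolventCocomp_subdiff L hk hJ hf hfJ,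
    ⟨hfJ.proxWellDefined hf, hJ.proxWellDefined hk, fun x => by rw [hprox, hJ.prox_eq hk]⟩,
    fun hg0 => ?_, fun hg0 => ?_⟩
  all_goals
    obtain ⟨K, hK⟩ := hg0.exists_isProxMap hg_minorant
    -- `K` is also a proximal map of `g**`, and proximal points are unique.
    have hKJ : K = J := funext fun z =>
      (hJ.mem_proxSet_iff hk).1 (((IsProxMap.mem_proxSet_iff
        (fun z => mem_subdiff_conj_conj hg (hK z)) hk)).2 rfl)
    subst hKJ
  · exact resolventCocomp_subdiff L hg hK hf hfJ
  · exact ⟨hK.proxWellDefined hg, fun x => by rw [hprox, hK.prox_eq hg]⟩
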